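/- Let $\mathbb D=\{z\in\mathbb C:|z|<1\}$. For analytic $f,g$ on $\mathbb D$ write $f\prec g$ if $f=g\circ w$ on $\mathbb D$ for some analytic $w:\mathbb D\to\mathbb D$ with $w(0)=0$; "univalent" means analytic and injective on $\mathbb D$. Let $\alpha,\mu$ be real with $0<\mu\le 1$, $\alpha+\mu\ge 0$, and let $\beta,\gamma,\delta\in\mathbb C$ with $\beta\ne0$. Let $\mathcal R$ be the class of analytic functions $p$ on $\mathbb D$ with $p(0)=1$ and $p(z)\neq 0$ in $\mathbb D$, for which $$F_p(z):=p(z)^{\alpha}\Big(p(z)+\delta+\frac{zp'(z)}{\beta p(z)+\gamma}\Big)^{\mu}\qquad(\text{principal powers})$$ is well defined, i.e. $\beta p+\gamma$ has no zero in $\mathbb D$ and $F_p$ is analytic in $\mathbb D$. For $p\in\mathcal R$ put $$G_p:=p^{\alpha/\mu+1}+\delta p^{\alpha/\mu}+p^{\alpha/\mu}\frac{zp'}{\beta p+\gamma},$$ where $p^{s}=e^{s\log p}$ with the analytic branch of $\log p$ on $\mathbb D$ that vanishes at $0$. Let $\mathcal Q$ be the class of functions $f$ that are analytic and injective on $\overline{\mathbb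 D}\setminus E(f)$, where $E(f)=\{\zeta\in\partial\mathbb D:\lim_{z\to\zeta}f(z)=\infty\}$, with $f'(\zeta)\ne0$ for $\zeta\in\partial\mathbb D\setminus E(f)$. **Theorem.** Let $q\in\mathcal R$ be univalent, put $R(z)=\dfrac{zq'(z)}{\beta q(z)+\gamma}$, and assume that for all $z\in\mathbb D$ $$\operatorname{Re}\Big((\beta q(z)+\gamma)\Big(1+\frac{\alpha}{\mu}+\frac{\alpha\delta}{\mu q(z)}\Big)\Big)>0,\qquad \operatorname{Re}\Big(\frac{\alpha}{\mu}\frac{zq'(z)}{q(z)}+\frac{zR'(z)}{R(z)}\Big)>0,$$ where $zR'(z)/R(z)$ takes its limit value $1$ at $z=0$. (i) If $p\in\mathcal R\cap\mathcal Q$, $G_p$ is univalent and $F_q\prec F_p$, then $q\prec p$. (ii) $q$ is the best subordinant of the differential superordination $F_q\prec F_p$. That is, call $p$ a solution if $p\in\mathcal R$, $p$ and $G_p$ are univalent and $F_q\prec F_p$, and call an analytic function $s$ on $\mathbb D$ a subordinant if $s\prec p$ for every solution $p$; then $q$ is a univalent subordinant, and $s\prec q$ for every subordinant $s$. -/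

import Mathlib

namespace DiffSubord

/-- The open unit disk `𝔻` of the complex plane. -/
def disk : Set ℂ := Metric.ball 0 1

/-- `f` is univalent in the unit disk: analytic and injective there. -/
def IsUnivalent (f : ℂ → ℂ) : Prop :=
  DifferentiableOn ℂ f disk ∧ Set.InjOn f disk

/-- `f ≺ g`: both are analytic in the unit disk and `f = g ∘ w` there for a Schwarz
function `w`. -/
def Subordinate (f g : ℂ → ℂ) : Prop :=
  DifferentiableOn ℂ f disk ∧ DifferentiableOn ℂ g disk ∧
    ∃ w : ℂ → ℂ, DifferentiableOn ℂ w disk ∧ w 0 = 0 ∧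
      (∀ z ∈ disk, ‖w z‖ < 1) ∧ ∀ z ∈ disk, f z = g (w z)

/-- `E(f)`: the boundary points `ζ` of the disk at which `f z → ∞` as `z → ζ` inside the disk. -/
def infinitePoints (f : ℂ → ℂ) : Set ℂ :=
  {ζ | ζ ∈ Metric.sphere (0 : ℂ) 1 ∧
    Filter.Tendsto f (nhdsWithin ζ disk) (Bornology.cobounded ℂ)}

/-- The class `𝒬`: functions on the disk that extend to a function analytic (in a
neighbourhood of each point) and injective on the closed disk minus `E(f)`, with nonvanishing
derivative at the points of the unit circle outside `E(f)`. Membership depends only on the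
values of `f` in the open disk. -/
def ClassQ (f : ℂ → ℂ) : Prop :=
  ∃ g : ℂ → ℂ, Set.EqOn g f disk ∧
    AnalyticOnNhd ℂ g (Metric.closedBall 0 1 \ infinitePoints f) ∧
    Set.InjOn g (Metric.closedBall 0 1 \ infinitePoints f) ∧
    ∀ ζ ∈ Metric.sphere (0 : ℂ) 1 \ infinitePoints f, deriv g ζ ≠ 0

/-- `z p'(z) / (β p(z) + γ)`. -/
noncomputable def quotTerm (β γ : ℂ) (p : ℂ → ℂ) (z : ℂ) : ℂ :=
  z * deriv p z / (β * p z + γ)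

/-- `p(z)^α (p(z) + δ + z p'(z) / (β p(z) + γ))^μ`, with principal powers. -/
noncomputable def powExpr (α : ℝ) (β γ δ : ℂ) (μ : ℝ) (p : ℂ → ℂ) (z : ℂ) : ℂ :=
  p z ^ (α : ℂ) * (p z + δ + quotTerm β γ p z) ^ (μ : ℂ)

/-- The class `ℛ(α, β, γ, δ, μ)`: analytic `p` with `p(0) = 1`, `p ≠ 0`, for which
`powExpr` is well defined as an analytic function in the disk. -/
structure ClassR (α : ℝ) (β γ δ : ℂ) (μ : ℝ) (p : ℂ → ℂ) : Prop where
  analytic : DifferentiableOn ℂ p disk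
  map_zero : p 0 = 1
  ne_zero : ∀ z ∈ disk, p z ≠ 0
  denom_ne_zero : ∀ z ∈ disk, β * p z + γ ≠ 0
  wellDefined : DifferentiableOn ℂ (powExpr α β γ δ μ p) disk

/-- `L` is the analytic logarithm of `p` in the disk with `L(0) = 0`. -/
def IsLogOf (L p : ℂ → ℂ) : Prop :=
  DifferentiableOn ℂ L disk ∧ L 0 = 0 ∧ ∀ z ∈ disk, Complex.exp (L z) = p z

/-- `p^{α/μ+1} + δ p^{α/μ} + p^{α/μ} z p' / (β p + γ)` is univalent in the disk, where
`p^s = exp (s L)` with `L = log p`, `L(0) = 0`. (`L` is unique on the disk.) This is the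
function given by the principal powers whenever the latter is analytic in the disk. -/
def ExprUnivalent (α : ℝ) (β γ δ : ℂ) (μ : ℝ) (p : ℂ → ℂ) : Prop :=
  ∃ L : ℂ → ℂ, IsLogOf L p ∧
    IsUnivalent (fun z =>
      Complex.exp (((α / μ + 1 : ℝ) : ℂ) * L z) + δ * Complex.exp (((α / μ : ℝ) : ℂ) * L z)
        + Complex.exp (((α / μ : ℝ) : ℂ) * L z) * quotTerm β γ p z)

/-- The solutions of the differential superordination `h ≺ p^α (p + δ + z p'/(β p + γ))^μ`:
univalent `p` in `ℛ` with univalent associated expression, satisfying the superordination. -/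
def solutions (α : ℝ) (β γ δ : ℂ) (μ : ℝ) (h : ℂ → ℂ) : Set (ℂ → ℂ) :=
  {p | ClassR α β γ δ μ p ∧ IsUnivalent p ∧ ExprUnivalent α β γ δ μ p ∧
    Subordinate h (powExpr α β γ δ μ p)}

/-- `s` is a subordinant: an analytic function subordinate to every solution. -/
def IsSubordinant (S : Set (ℂ → ℂ)) (s : ℂ → ℂ) : Prop :=
  DifferentiableOn ℂ s disk ∧ ∀ p ∈ S, Subordinate s p

/-- `q` is the best subordinant: a univalent subordinant to which every subordinant is
subordinate. -/
def IsBestSubordinant (S : Set (ℂ → ℂ)) (q : ℂ → ℂ) : Prop :=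
  IsUnivalent q ∧ IsSubordinant S q ∧ ∀ s : ℂ → ℂ, IsSubordinant S s → Subordinate s q

end DiffSubord

open Set Filter Topology Metric Complex

/-! ### Analytic inverses, logarithms and Jack's lemma. -/

namespace DiffSubord

/-! Put a = α/μ, Q = q^a R and Θ = q^{a+1} + δ q^a, so that G_q = Θ + Q. The two hypotheses on q say
Re(zQ'/Q) > 0 and Re(zΘ'/Q) > 0. For fixed c consider the zeros of Q + s(Θ - c), s ≥ 0. For s > 0
and z ≠ 0 they are the solutions of σ(z) = s with σ = Q/(c - Θ), and zσ'/σ = zQ'/Q + s zΘ'/Q has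
positive real part; hence zeros can be followed as s decreases and move no farther from 0. At s = 0
only the origin is left. This flow does the work of a subordination chain. Following two zeros from
s = 1 to s = 0 makes G_q univalent (`StarlikePair.injOn`).

Principal powers are removed through |F| = |G|^μ: the superordination becomes G_q = G_p ∘ w
(`logExpr_eq_comp`).

Suppose q(𝔻) is not contained in p(𝔻). Then ω = p⁻¹ ∘ q reaches modulus r > |z₀| at some first point
z₀, and Jack's lemma gives z₀ω'(z₀) = m ω(z₀) with m ≥ 1. Thus z₀ is a zero of Q + m(Θ - c) for c =
G_p(ω(z₀)). Following it down to s = 1 gives z₂ with |z₂| ≤ |z₀| and G_q(z₂) = c. Univalence of G_p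
forces w(z₂) = ω(z₀), so that r ≤ |z₂| < r by Schwarz, a contradiction
(`image_subset_of_logExpr_eq`).

Part (ii) follows because q is itself a solution. -/

theorem isOpen_disk : IsOpen disk := isOpen_ball

theorem mem_disk {z : ℂ} : z ∈ disk ↔ ‖z‖ < 1 := by simp [disk]

theorem zero_mem_disk : (0 : ℂ) ∈ disk := by simp [disk]

theorem isPreconnected_disk : IsPreconnected disk := (convex_ball 0 1).isPreconnected

/-- The derivative of an injective analytic function vanishes nowhere, and its inverse is
analytic on the image. -/
theorem deriv_ne_zero_and_differentiableAt_inv {f g : ℂ → ℂ} {U : Set ℂ} (hU : IsOpen U)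
    (hf : DifferentiableOn ℂ f U) (hg : ∀ z ∈ U, g (f z) = z) {z : ℂ} (hz : z ∈ U) :
    deriv f z ≠ 0 ∧ DifferentiableAt ℂ g (f z) ∧ f '' U ∈ 𝓝 (f z) := by
  have han : ∀ z ∈ U, AnalyticAt ℂ f z := fun z hz => hf.analyticAt (hU.mem_nhds hz)
  have hopen : ∀ z ∈ U, 𝓝 (f z) ≤ map f (𝓝 z) := by
    intro z hz
    refine (han z hz).eventually_constant_or_nhds_le_map_nhds.resolve_left fun h => ?_
    have h2 : ∀ᶠ w in 𝓝 z, w = z := by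
      filter_upwards [h, hU.mem_nhds hz] with w hw hwU
      rw [← hg w hwU, hw, hg z hz]
    have : ∀ᶠ w in 𝓝[≠] z, w = z := h2.filter_mono nhdsWithin_le_nhds
    obtain ⟨w, hw1, hw2⟩ := (this.and self_mem_nhdsWithin).exists
    exact hw2 hw1
  have himg : ∀ z ∈ U, f '' U ∈ 𝓝 (f z) := fun z hz =>
    hopen z hz (image_mem_map (hU.mem_nhds hz))
  have hcont : ∀ z ∈ U, ContinuousAt g (f z) := by
    intro z hz
    have : Tendsto g (map f (𝓝 z)) (𝓝 z) := by
      refine tendsto_map'_iff.2 (Tendsto.congr' ?_ tendsto_id)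
      filter_upwards [hU.mem_nhds hz] with w hw using (hg w hw).symm
    unfold ContinuousAt
    rw [hg z hz]
    exact this.mono_left (hopen z hz)
  have hder : ∀ z ∈ U, deriv f z ≠ 0 → DifferentiableAt ℂ g (f z) := by
    intro z hz h
    refine (((han z hz).hasStrictDerivAt).to_local_left_inverse h ?_).hasDerivAt.differentiableAt
    filter_upwards [hU.mem_nhds hz] with w hw using hg w hw
  have hiso : ∀ᶠ w in 𝓝[≠] z, deriv f w ≠ 0 := by
    refine (han z hz).deriv.eventually_eq_zero_or_eventually_ne_zero.resolve_left fun h => ?_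
    obtain ⟨ε, hε, hb⟩ := Metric.eventually_nhds_iff_ball.1 (h.and (hU.mem_nhds hz))
    have hc : ∀ w ∈ ball z ε, f w = f z := by
      intro w hw
      refine isOpen_ball.is_const_of_deriv_eq_zero (convex_ball z ε).isPreconnected
        (hf.mono fun x hx => (hb x hx).2) (fun x hx => (hb x hx).1) hw (mem_ball_self hε)
    have h2 : ∀ᶠ w in 𝓝[≠] z, w = z := by
      refine Filter.Eventually.filter_mono nhdsWithin_le_nhds ?_
      filter_upwards [ball_mem_nhds z hε] with w hw
      rw [← hg w (hb w hw).2, hc w hw, hg z hz]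
    obtain ⟨w, hw1, hw2⟩ := (h2.and self_mem_nhdsWithin).exists
    exact hw2 hw1
  -- Zeros of `deriv f` are isolated, so `g` is differentiable on a punctured neighbourhood of `f
  -- z`; being continuous there, it has a removable singularity.
  have hd : DifferentiableAt ℂ g (f z) := by
    refine (analyticAt_of_differentiable_on_punctured_nhds_of_continuousAt ?_
      (hcont z hz)).differentiableAt
    have hg' : Tendsto g (𝓝[≠] (f z)) (𝓝[≠] z) := by
      refine tendsto_nhdsWithin_iff.2 ⟨?_, ?_⟩
      · have := hcont z hz
        unfold ContinuousAt at this
        rw [hg z hz] at this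
        exact this.mono_left nhdsWithin_le_nhds
      · filter_upwards [self_mem_nhdsWithin, mem_nhdsWithin_of_mem_nhds (himg z hz)] with w hw hw'
        obtain ⟨x, hx, rfl⟩ := hw'
        rw [hg x hx]
        rintro rfl
        exact hw rfl
    filter_upwards [hg'.eventually hiso, mem_nhdsWithin_of_mem_nhds (himg z hz)] with w hw hw'
    obtain ⟨x, hx, rfl⟩ := hw'
    rw [hg x hx] at hw
    exact hder x hx hw
  refine ⟨fun h0 => ?_, hd, himg z hz⟩
  have h1 : HasDerivAt (g ∘ f) (deriv g (f z) * deriv f z) z :=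
    hd.hasDerivAt.comp z (han z hz).differentiableAt.hasDerivAt
  have h2 : HasDerivAt (g ∘ f) 1 z := by
    refine (hasDerivAt_id z).congr_of_eventuallyEq ?_
    filter_upwards [hU.mem_nhds hz] with w hw using hg w hw
  have := h1.unique h2
  simp [h0] at this

theorem deriv_ne_zero_of_injOn {f : ℂ → ℂ} {U : Set ℂ} (hU : IsOpen U)
    (hf : DifferentiableOn ℂ f U) (hinj : InjOn f U) {z : ℂ} (hz : z ∈ U) : deriv f z ≠ 0 :=
  (deriv_ne_zero_and_differentiableAt_inv hU hf
    (fun _ hz => hinj.leftInvOn_invFunOn hz) hz).1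

theorem exists_isLogOf {p : ℂ → ℂ} (hp : DifferentiableOn ℂ p disk) (h0 : p 0 = 1)
    (hne : ∀ z ∈ disk, p z ≠ 0) : ∃ L, IsLogOf L p := by
  have hd : DifferentiableOn ℂ (fun z => deriv p z / p z) disk :=
    (hp.deriv isOpen_disk).div hp hne
  obtain ⟨L, hL⟩ := hd.isExactOn_ball
  have hLd : DifferentiableOn ℂ (fun z => L z - L 0) disk := fun z hz =>
    ((hL z hz).sub_const _).differentiableAt.differentiableWithinAt
  refine ⟨fun z => L z - L 0, hLd, by simp, fun z hz => ?_⟩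
  have key : ∀ w ∈ disk, HasDerivAt (fun z => p z * exp (-(L z - L 0))) 0 w := by
    intro w hw
    have h1 := (hp.differentiableAt (isOpen_disk.mem_nhds hw)).hasDerivAt
    have h2 := ((hL w hw).sub_const (L 0)).neg.cexp
    refine (h1.mul h2).congr_deriv ?_
    have e : p w * (deriv p w / p w) = deriv p w := mul_div_cancel₀ _ (hne w hw)
    linear_combination (-exp (-(L w - L 0))) * e
  have hc := isOpen_disk.is_const_of_deriv_eq_zero isPreconnected_disk
    (fun w hw => (key w hw).differentiableAt.differentiableWithinAt)
    (fun w hw => (key w hw).deriv) hz zero_mem_disk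
  simp only [h0, sub_self, neg_zero, exp_zero, mul_one, exp_neg] at hc
  field_simp at hc
  exact hc.symm

theorem hasDerivAt_of_isLogOf {L p : ℂ → ℂ} (h : IsLogOf L p) {z : ℂ} (hz : z ∈ disk) :
    HasDerivAt L (deriv p z / p z) z := by
  have hL := (h.1.differentiableAt (isOpen_disk.mem_nhds hz)).hasDerivAt
  have h2 : HasDerivAt p (exp (L z) * deriv L z) z := by
    refine hL.cexp.congr_of_eventuallyEq ?_
    filter_upwards [isOpen_disk.mem_nhds hz] with w hw using (h.2.2 w hw).symm
  rw [h2.deriv, ← h.2.2 z hz, mul_div_cancel_left₀ _ (exp_ne_zero _)]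
  exact hL

theorem hasDerivAt_normSq_comp {f : ℂ → ℂ} {c : ℝ → ℂ} {f' c' : ℂ} {t : ℝ}
    (hf : HasDerivAt f f' (c t)) (hc : HasDerivAt c c' t) :
    HasDerivAt (fun s => ‖f (c s)‖ ^ 2) (2 * (f' * c' * (starRingEnd ℂ) (f (c t))).re) t := by
  have h := (hf.scomp t hc).norm_sq
  simp only [Function.comp_def, smul_eq_mul] at h
  convert h using 1
  rw [Complex.inner]
  congr 2
  ring

/-- Jack's lemma: if `‖ω z‖ ≤ (r / ‖z₀‖) ‖z‖` for `‖z‖ ≤ ‖z₀‖` with equality at `z₀`, then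
`z₀ ω'(z₀) = m ω(z₀)` with a real `m ≥ 1`. -/
theorem jack {ω : ℂ → ℂ} {z₀ : ℂ} (hd : DifferentiableAt ℂ ω z₀) (hω : ω z₀ ≠ 0)
    (hz₀ : z₀ ≠ 0)
    (hle : ∀ z, ‖z‖ ≤ ‖z₀‖ → ‖ω z‖ ≤ ‖ω z₀‖ / ‖z₀‖ * ‖z‖) :
    ∃ m : ℝ, 1 ≤ m ∧ z₀ * deriv ω z₀ = m * ω z₀ := by
  have hr : 0 < ‖ω z₀‖ := norm_pos_iff.2 hω
  have hn : 0 < ‖z₀‖ := norm_pos_iff.2 hz₀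
  -- Paths `z₀ exp (t v)`: `v = I` runs along the circle, where `‖ω‖` is maximal at `t = 0`; `v = 1`
  -- runs along the radius, where `‖ω‖ ^ 2` stays below `‖ω z₀‖ ^ 2 * exp (2 t)` for `t ≤ 0`.
  have hc : ∀ v : ℂ, HasDerivAt (fun t : ℝ => ‖ω (z₀ * exp (t * v))‖ ^ 2)
      (2 * (deriv ω z₀ * (z₀ * v) * (starRingEnd ℂ) (ω z₀)).re) 0 := by
    intro v
    have h1 : HasDerivAt (fun t : ℝ => z₀ * exp (t * v)) (z₀ * v) 0 := by
      have := ((((hasDerivAt_id (0 : ℝ)).ofReal_comp).mul_const v).cexp).const_mul z₀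
      simpa using! this
    have h2 : HasDerivAt ω (deriv ω z₀) (z₀ * exp (((0 : ℝ) : ℂ) * v)) := by
      simpa using hd.hasDerivAt
    simpa using hasDerivAt_normSq_comp (c := fun t : ℝ => z₀ * exp (t * v)) h2 h1
  set B := deriv ω z₀ * z₀ * (starRingEnd ℂ) (ω z₀) with hB
  have him : B.im = 0 := by
    have h := hc I
    have hmax : IsLocalMax (fun t : ℝ => ‖ω (z₀ * exp (t * I))‖ ^ 2) 0 := by
      refine Eventually.of_forall fun t => ?_
      have := hle (z₀ * exp (t * I)) (by simp [norm_exp])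
      simp only [norm_mul, norm_exp_ofReal_mul_I, mul_one] at this
      rw [div_mul_cancel₀ _ hn.ne'] at this
      simp only [ofReal_zero, zero_mul, exp_zero, mul_one]
      gcongr
    have h0 := hmax.hasDerivAt_eq_zero h
    have e : deriv ω z₀ * (z₀ * I) * (starRingEnd ℂ) (ω z₀) = B * I := by rw [hB]; ring
    rw [e, mul_I_re] at h0
    linarith
  have hre : ‖ω z₀‖ ^ 2 ≤ B.re := by
    have h := hc 1
    have hE : HasDerivAt (fun t : ℝ => ‖ω z₀‖ ^ 2 * Real.exp (2 * t)) (2 * ‖ω z₀‖ ^ 2) 0 := by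
      have := (((hasDerivAt_id (0 : ℝ)).const_mul 2).exp).const_mul (‖ω z₀‖ ^ 2)
      simp only [id, mul_zero, Real.exp_zero, mul_one, one_mul] at this
      exact this.congr_deriv (mul_comm _ _)
    have hD := hE.sub h
    have hmin : ∀ t : ℝ, t ≤ 0 →
        0 ≤ ‖ω z₀‖ ^ 2 * Real.exp (2 * t) - ‖ω (z₀ * exp (t * 1))‖ ^ 2 := by
      intro t ht
      have hx : ‖exp ((t : ℂ) * 1)‖ = Real.exp t := by simp [norm_exp]
      have := hle (z₀ * exp (t * 1)) (by
        rw [norm_mul, hx]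
        exact mul_le_of_le_one_right hn.le (Real.exp_le_one_iff.2 ht))
      rw [norm_mul, hx, ← mul_assoc, div_mul_cancel₀ _ hn.ne'] at this
      have h2 : ‖ω (z₀ * exp (t * 1))‖ ^ 2 ≤ (‖ω z₀‖ * Real.exp t) ^ 2 := by gcongr
      rw [mul_pow, ← Real.exp_nat_mul] at h2
      push_cast at h2
      linarith
    have hle0 : 2 * ‖ω z₀‖ ^ 2 - 2 * (deriv ω z₀ * (z₀ * 1) * (starRingEnd ℂ) (ω z₀)).re ≤ 0 := by
      have hlim := (hasDerivAt_iff_tendsto_slope.1 hD).mono_left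
        (nhdsWithin_mono (0 : ℝ) (fun x (hx : x ∈ Iio 0) => ne_of_lt hx))
      refine le_of_tendsto hlim ?_
      filter_upwards [self_mem_nhdsWithin] with t ht
      have ht : t < 0 := ht
      rw [slope_def_field]
      refine div_nonpos_of_nonneg_of_nonpos ?_ (by linarith)
      have := hmin t ht.le
      simpa using this
    have e : deriv ω z₀ * (z₀ * 1) * (starRingEnd ℂ) (ω z₀) = B := by rw [hB]; ring
    rw [e] at hle0
    linarith
  refine ⟨B.re / ‖ω z₀‖ ^ 2, (one_le_div (by positivity)).2 hre, ?_⟩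
  have hBr : B = (B.re : ℂ) := Complex.ext rfl (by simp [him])
  have hcj : (starRingEnd ℂ) (ω z₀) ≠ 0 := by simpa using hω
  push_cast
  rw [← hBr, hB, ← Complex.mul_conj']
  field_simp

end DiffSubord

/-! ### Following the zeros of Q + s(Θ - c) as s decreases. -/

namespace DiffSubord

/-- A pair `Q, Θ` of analytic functions on the disk with `Q(z) = z Q₁(z)`, `Q₁ ≠ 0`,
`Re (Q' / Q₁) > 0` and `Re (Θ' / Q₁) > 0`: `Q` is starlike and `Θ` is close-to-convex with
respect to `Q`. -/
structure StarlikePair (Q Θ Q₁ P H : ℂ → ℂ) : Prop where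
  eq_mul : ∀ z, Q z = z * Q₁ z
  ne_zero : ∀ z ∈ disk, Q₁ z ≠ 0
  hasDerivAt_left : ∀ z ∈ disk, HasDerivAt Q (Q₁ z * P z) z
  hasDerivAt_right : ∀ z ∈ disk, HasDerivAt Θ (Q₁ z * H z) z
  re_pos_left : ∀ z ∈ disk, 0 < (P z).re
  re_pos_right : ∀ z ∈ disk, 0 < (H z).re

namespace StarlikePair

variable {Q Θ Q₁ P H : ℂ → ℂ}

theorem hasStrictDerivAt_left (h : StarlikePair Q Θ Q₁ P H) {z : ℂ} (hz : z ∈ disk) :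
    HasStrictDerivAt Q (Q₁ z * P z) z := by
  rw [← (h.hasDerivAt_left z hz).deriv]
  have : DifferentiableOn ℂ Q disk := fun z hz =>
    (h.hasDerivAt_left z hz).differentiableAt.differentiableWithinAt
  exact (this.analyticAt (isOpen_disk.mem_nhds hz)).hasStrictDerivAt

theorem hasStrictDerivAt_right (h : StarlikePair Q Θ Q₁ P H) {z : ℂ} (hz : z ∈ disk) :
    HasStrictDerivAt Θ (Q₁ z * H z) z := by
  rw [← (h.hasDerivAt_right z hz).deriv]
  have : DifferentiableOn ℂ Θ disk := fun z hz =>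
    (h.hasDerivAt_right z hz).differentiableAt.differentiableWithinAt
  exact (this.analyticAt (isOpen_disk.mem_nhds hz)).hasStrictDerivAt

theorem map_zero (h : StarlikePair Q Θ Q₁ P H) : Q 0 = 0 := by simp [h.eq_mul]

theorem eq_zero (h : StarlikePair Q Θ Q₁ P H) {z : ℂ} (hz : z ∈ disk) (h0 : Q z = 0) :
    z = 0 := by
  rw [h.eq_mul] at h0
  exact (mul_eq_zero.1 h0).resolve_right (h.ne_zero z hz)

theorem re_add_pos (h : StarlikePair Q Θ Q₁ P H) {z : ℂ} (hz : z ∈ disk) {s : ℝ}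
    (hs : 0 ≤ s) : 0 < (P z + s * H z).re := by
  have h1 := h.re_pos_left z hz
  have h2 := h.re_pos_right z hz
  simp only [add_re, re_ofReal_mul]
  positivity

theorem continuousOn_left (h : StarlikePair Q Θ Q₁ P H) : ContinuousOn Q disk := fun z hz =>
  (h.hasDerivAt_left z hz).continuousAt.continuousWithinAt

theorem continuousOn_right (h : StarlikePair Q Θ Q₁ P H) : ContinuousOn Θ disk := fun z hz =>
  (h.hasDerivAt_right z hz).continuousAt.continuousWithinAt

/-- A zero of `Q + s (Θ - c)` can be followed locally in `s`, and its modulus does not increase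
as `s` decreases. -/
theorem exists_local_flow (h : StarlikePair Q Θ Q₁ P H) {c z : ℂ} {s : ℝ} (hs : 0 < s)
    (hz : z ∈ disk) (hk : Q z + s * (Θ z - c) = 0) :
    ∃ ψ : ℝ → ℂ, ContinuousAt ψ s ∧ ψ s = z ∧
      (∀ᶠ t in 𝓝 s, Q (ψ t) + t * (Θ (ψ t) - c) = 0) ∧ ∀ᶠ t in 𝓝[<] s, ‖ψ t‖ ≤ ‖z‖ := by
  have hsC : (s : ℂ) ≠ 0 := by exact_mod_cast hs.ne'
  -- At the origin `Q` vanishes, which forces `Θ 0 = c`; the constant path then works.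
  by_cases hz0 : z = 0
  · subst hz0
    refine ⟨fun _ => 0, continuousAt_const, rfl, ?_, by simp⟩
    rw [h.map_zero, zero_add] at hk
    have := (mul_eq_zero.1 hk).resolve_left hsC
    simp [h.map_zero, this]
  have hΘ : c - Θ z ≠ 0 := by
    intro h0
    have : Θ z - c = 0 := by linear_combination -h0
    rw [this, mul_zero, add_zero] at hk
    exact hz0 (h.eq_zero hz hk)
  have hQ : Q z = s * (c - Θ z) := by linear_combination hk
  have hQ1 := h.ne_zero z hz
  have hW := h.re_add_pos hz hs.le
  set W := P z + s * H z with hWd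
  have hW0 : W ≠ 0 := by
    intro h0
    rw [h0] at hW
    simp at hW
  -- The zeros for parameter `s` form the level set `σ = s`, and `z σ' / σ = P + s H = W` there; the
  -- path is a local inverse of `σ`.
  set σ : ℂ → ℂ := fun z => Q z / (c - Θ z) with hσ
  have hσz : σ z = s := by simp only [hσ, hQ]; field_simp
  have hσd : HasStrictDerivAt σ (s * W / z) z := by
    refine ((h.hasStrictDerivAt_left hz).div ((h.hasStrictDerivAt_right hz).const_sub c)
      hΘ).congr_deriv ?_
    have e : c - Θ z = z * Q₁ z / s := by
      rw [eq_div_iff hsC, ← h.eq_mul, hQ]; ring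
    rw [e, h.eq_mul z, hWd]
    field_simp
    ring
  have hσ0 : s * W / z ≠ 0 := div_ne_zero (mul_ne_zero hsC hW0) hz0
  set φ := hσd.localInverse σ _ z hσ0 with hφ
  have hφd : HasStrictDerivAt φ (s * W / z)⁻¹ (σ z) := hσd.to_localInverse hσ0
  have hφz : φ (σ z) = z := (hσd.eventually_left_inverse hσ0).self_of_nhds
  rw [hσz] at hφd hφz
  have hψd : HasDerivAt (fun t : ℝ => φ t) (s * W / z)⁻¹ s := hφd.hasDerivAt.comp_ofReal
  have hψ0 : ContinuousAt (fun t : ℝ => φ t) s := hψd.continuousAt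
  refine ⟨fun t => φ t, hψ0, hφz, ?_, ?_⟩
  · have h1 : ∀ᶠ x in 𝓝 (σ z), σ (φ x) = x := hσd.eventually_right_inverse hσ0
    rw [hσz] at h1
    have h2 : ∀ᶠ t : ℝ in 𝓝 s, σ (φ t) = t :=
      (continuous_ofReal.tendsto s).eventually h1
    have h3 : ∀ᶠ w in 𝓝 z, c - Θ w ≠ 0 :=
      ((h.hasDerivAt_right z hz).continuousAt.const_sub c).eventually_ne hΘ
    have h4 : ∀ᶠ t : ℝ in 𝓝 s, c - Θ (φ t) ≠ 0 := by
      have : Tendsto (fun t : ℝ => φ t) (𝓝 s) (𝓝 z) := by simpa [ContinuousAt, hφz] using hψ0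
      exact this.eventually h3
    filter_upwards [h2, h4] with t ht ht'
    simp only [hσ] at ht
    rw [div_eq_iff ht'] at ht
    rw [ht]; ring
  · have hn : HasDerivAt (fun t : ℝ => ‖φ t‖ ^ 2)
        (2 * ((s * W / z)⁻¹ * (starRingEnd ℂ) z).re) s := by
      have := hasDerivAt_normSq_comp (f := id) (c := fun t : ℝ => φ t) (hasDerivAt_id _) hψd
      simpa [hφz] using this
    have hpos : 0 < 2 * ((s * W / z)⁻¹ * (starRingEnd ℂ) z).re := by
      have e : (s * W / z)⁻¹ * (starRingEnd ℂ) z =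
          ((‖z‖ ^ 2 * s⁻¹ * (‖W‖ ^ 2)⁻¹ : ℝ) : ℂ) * (starRingEnd ℂ) W := by
        have hcW : (starRingEnd ℂ) W ≠ 0 := by simpa using hW0
        push_cast
        rw [← Complex.mul_conj', ← Complex.mul_conj']
        field_simp
      rw [e, re_ofReal_mul, conj_re]
      have : 0 < ‖z‖ := norm_pos_iff.2 hz0
      have : 0 < ‖W‖ := norm_pos_iff.2 hW0
      positivity
    have hlim := (hasDerivAt_iff_tendsto_slope.1 hn).mono_left
        (nhdsWithin_mono s (fun x (hx : x ∈ Iio s) => ne_of_lt hx))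
    filter_upwards [hlim.eventually_const_lt hpos, self_mem_nhdsWithin] with t ht hts
    have hts : t < s := hts
    rw [slope_def_field, hφz] at ht
    have : ‖φ t‖ ^ 2 - ‖z‖ ^ 2 < 0 := by
      by_contra hcon
      exact absurd ht (not_lt.2 (div_nonpos_of_nonneg_of_nonpos (not_lt.1 hcon) (by linarith)))
    exact (pow_le_pow_iff_left₀ (norm_nonneg _) (norm_nonneg _) two_ne_zero).1 (by linarith)

theorem isCompact_zeros (h : StarlikePair Q Θ Q₁ P H) (c : ℂ) {r a b : ℝ} (hr : r < 1) :
    IsCompact {x : ℝ × ℂ | x ∈ Icc a b ×ˢ closedBall (0 : ℂ) r ∧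
      Q x.2 + x.1 * (Θ x.2 - c) = 0} := by
  have hsub : closedBall (0 : ℂ) r ⊆ disk := closedBall_subset_ball hr
  have hK : IsCompact (Icc a b ×ˢ closedBall (0 : ℂ) r) :=
    isCompact_Icc.prod (isCompact_closedBall _ _)
  have hcont : ContinuousOn (fun x : ℝ × ℂ => Q x.2 + x.1 * (Θ x.2 - c))
      (Icc a b ×ˢ closedBall (0 : ℂ) r) := by
    have hm : MapsTo (Prod.snd : ℝ × ℂ → ℂ) (Icc a b ×ˢ closedBall (0 : ℂ) r) disk :=
      fun x hx => hsub hx.2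
    have h1 := h.continuousOn_left.comp continuousOn_snd hm
    have h2 := h.continuousOn_right.comp continuousOn_snd hm
    exact h1.add ((continuous_ofReal.comp continuous_fst).continuousOn.mul
      (h2.sub continuousOn_const))
  exact hK.of_isClosed_subset
    (hcont.preimage_isClosed_of_isClosed hK.isClosed isClosed_singleton) fun x hx => hx.1

/-- A zero of `Q + s (Θ - c)` for `s = b` yields one of no larger modulus for every smaller
positive `s`. -/
theorem exists_zero_of_le (h : StarlikePair Q Θ Q₁ P H) {c z : ℂ} {a b : ℝ} (ha : 0 < a)
    (hab : a ≤ b) (hz : z ∈ disk) (hk : Q z + b * (Θ z - c) = 0) :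
    ∃ w, ‖w‖ ≤ ‖z‖ ∧ Q w + a * (Θ w - c) = 0 := by
  set S : Set ℝ := {s | ∃ w, ‖w‖ ≤ ‖z‖ ∧ Q w + s * (Θ w - c) = 0} with hS
  have hzn := mem_disk.1 hz
  have hcl : IsClosed (S ∩ Icc a b) := by
    convert ((h.isCompact_zeros c (a := a) (b := b) hzn).image continuous_fst).isClosed using 1
    ext s
    constructor
    · rintro ⟨⟨w, hw, hw'⟩, hs⟩
      exact ⟨(s, w), ⟨⟨hs, by simpa using hw⟩, hw'⟩, rfl⟩
    · rintro ⟨⟨s, w⟩, ⟨⟨hs, hw⟩, hw'⟩, rfl⟩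
      exact ⟨⟨w, by simpa using hw, hw'⟩, hs⟩
  -- Continuous induction downwards from `b`: the set of good parameters is closed by compactness,
  -- and the local flow extends it to the left.
  refine hcl.Icc_subset_of_forall_exists_lt ⟨z, le_rfl, hk⟩ ?_ ⟨le_rfl, hab⟩
  rintro s ⟨⟨w, hw, hw'⟩, hs⟩ y hy
  obtain ⟨ψ, -, -, h1, h2⟩ := h.exists_local_flow (ha.trans hs.1)
    (mem_disk.2 (hw.trans_lt hzn)) hw'
  obtain ⟨t, ⟨ht1, ht2⟩, ht3⟩ :=
    (((h1.filter_mono nhdsWithin_le_nhds).and h2).and (Ico_mem_nhdsLT hy)).exists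
  exact ⟨t, ⟨ψ t, ht2.trans hw, ht1⟩, ht3⟩

/-- The derivative of `Q + s (Θ - c)` in `z` is `V = Q₁ (P + s H) ≠ 0`, so zeros are simple. Strict
differentiability makes this uniform in nearby parameters, and two distinct zeros cannot merge in
the limit. -/
theorem eventually_not_two_zeros (h : StarlikePair Q Θ Q₁ P H) (c : ℂ) {z : ℂ} {s : ℝ}
    (hs : 0 ≤ s) (hz : z ∈ disk) :
    ∀ᶠ x : ℝ × ℂ × ℂ in 𝓝 (s, z, z), Q x.2.1 + x.1 * (Θ x.2.1 - c) = 0 →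
      Q x.2.2 + x.1 * (Θ x.2.2 - c) = 0 → x.2.1 = x.2.2 := by
  set V := Q₁ z * (P z + s * H z) with hV
  have hV0 : V ≠ 0 := by
    refine mul_ne_zero (h.ne_zero z hz) fun h0 => ?_
    have := h.re_add_pos hz hs
    rw [h0] at this
    simp at this
  have hVn : 0 < ‖V‖ := norm_pos_iff.2 hV0
  have hQ := (h.hasStrictDerivAt_left hz).isLittleO
  have hΘ := (h.hasStrictDerivAt_right hz).isLittleO
  have hsnd : Tendsto (fun x : ℝ × ℂ × ℂ => x.2) (𝓝 (s, z, z)) (𝓝 (z, z)) := by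
    exact continuous_snd.tendsto _
  have hfst : Tendsto (fun x : ℝ × ℂ × ℂ => (x.1 : ℂ)) (𝓝 (s, z, z)) (𝓝 (s : ℂ)) := by
    exact (continuous_ofReal.comp continuous_fst).tendsto _
  have h1 := hQ.comp_tendsto hsnd
  have h2 := ((hfst.isBigO_one ℂ).mul_isLittleO (hΘ.comp_tendsto hsnd))
  -- Error made by freezing the parameter `x.1` at `s` in the linear part.
  have h3 : (fun x : ℝ × ℂ × ℂ => ((x.1 : ℂ) - s) * (Q₁ z * H z * (x.2.1 - x.2.2)))
      =o[𝓝 (s, z, z)] fun x => x.2.1 - x.2.2 := by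
    have h31 : (fun x : ℝ × ℂ × ℂ => ((x.1 : ℂ) - s)) =o[𝓝 (s, z, z)] fun _ => (1 : ℂ) := by
      rw [Asymptotics.isLittleO_one_iff]
      simpa using hfst.sub_const (s : ℂ)
    have h32 : (fun x : ℝ × ℂ × ℂ => Q₁ z * H z * (x.2.1 - x.2.2))
        =O[𝓝 (s, z, z)] fun x => x.2.1 - x.2.2 :=
      Asymptotics.isBigO_const_mul_self _ _ _
    simpa using h31.mul_isBigO h32
  have h2' : (fun x : ℝ × ℂ × ℂ => x.1 * (Θ x.2.1 - Θ x.2.2 - (x.2.1 - x.2.2) • (Q₁ z * H z)))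
      =o[𝓝 (s, z, z)] fun x => x.2.1 - x.2.2 := by
    simpa [Function.comp_def] using h2
  have h4 := ((h1.add h2').add h3).bound (half_pos hVn)
  filter_upwards [h4] with x hx ha hb
  by_contra hne
  have hd : 0 < ‖x.2.1 - x.2.2‖ := norm_pos_iff.2 (sub_ne_zero.2 hne)
  have e : (Q x.2.1 - Q x.2.2 - (x.2.1 - x.2.2) • (Q₁ z * P z)) +
      x.1 * (Θ x.2.1 - Θ x.2.2 - (x.2.1 - x.2.2) • (Q₁ z * H z)) +
      ((x.1 : ℂ) - s) * (Q₁ z * H z * (x.2.1 - x.2.2)) = -(V * (x.2.1 - x.2.2)) := by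
    simp only [smul_eq_mul, hV]
    linear_combination ha - hb
  simp only [Function.comp_def] at hx
  have hx' : ‖-(V * (x.2.1 - x.2.2))‖ ≤ ‖V‖ / 2 * ‖x.2.1 - x.2.2‖ := by
    rw [← e]
    simpa using hx
  rw [norm_neg, norm_mul] at hx'
  nlinarith

/-- If `Q` is starlike and `Θ` is close-to-convex with respect to `Q`, then `Θ + Q` is
univalent. -/
theorem injOn (h : StarlikePair Q Θ Q₁ P H) : InjOn (fun z => Θ z + Q z) disk := by
  intro z₁ hz₁ z₂ hz₂ heq
  by_contra hne
  simp only at heq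
  set c := Θ z₁ + Q z₁ with hc
  obtain ⟨r, hr1, hr⟩ : ∃ r < 1, ‖z₁‖ ≤ r ∧ ‖z₂‖ ≤ r :=
    ⟨max ‖z₁‖ ‖z₂‖, max_lt (mem_disk.1 hz₁) (mem_disk.1 hz₂), le_max_left _ _, le_max_right _ _⟩
  set S : Set ℝ := {s | ∃ a b, a ≠ b ∧ ‖a‖ ≤ r ∧ ‖b‖ ≤ r ∧ Q a + s * (Θ a - c) = 0 ∧
    Q b + s * (Θ b - c) = 0} with hS
  have hdisk : ∀ {a : ℂ}, ‖a‖ ≤ r → a ∈ disk := fun ha => mem_disk.2 (ha.trans_lt hr1)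
  have hcl : IsClosed (S ∩ Icc 0 1) := by
    set Z := {x : ℝ × ℂ | x ∈ Icc (0 : ℝ) 1 ×ˢ closedBall (0 : ℂ) r ∧
      Q x.2 + x.1 * (Θ x.2 - c) = 0} with hZ
    have hZc : IsCompact Z := h.isCompact_zeros c hr1
    set T : Set (ℝ × ℂ × ℂ) := {x | (x.1, x.2.1) ∈ Z ∧ (x.1, x.2.2) ∈ Z ∧ x.2.1 ≠ x.2.2} with hT
    -- A limit of pairs of distinct zeros could only leave `T` by collapsing to a double zero.
    have hTcl : IsClosed T := by
      refine isClosed_of_closure_subset fun x hx => ?_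
      have hx1 : (x.1, x.2.1) ∈ Z := by
        have hc1 : Continuous fun x : ℝ × ℂ × ℂ => (x.1, x.2.1) := by fun_prop
        exact closure_minimal (fun y hy => hy.1) (hZc.isClosed.preimage hc1) hx
      have hx2 : (x.1, x.2.2) ∈ Z := by
        have hc1 : Continuous fun x : ℝ × ℂ × ℂ => (x.1, x.2.2) := by fun_prop
        exact closure_minimal (fun y hy => hy.2.1) (hZc.isClosed.preimage hc1) hx
      refine ⟨hx1, hx2, fun he => ?_⟩
      have hxe : x = (x.1, x.2.1, x.2.1) := by
        refine Prod.ext rfl (Prod.ext rfl he.symm)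
      have hev := h.eventually_not_two_zeros c hx1.1.1.1
        (hdisk (by simpa using hx1.1.2))
      rw [← hxe] at hev
      obtain ⟨y, hy, hyT⟩ := mem_closure_iff_nhds.1 hx _ hev
      exact hyT.2.2 (hy hyT.1.2 hyT.2.1.2)
    have hTc : IsCompact T := by
      refine ((isCompact_Icc (a := (0 : ℝ)) (b := 1)).prod ((isCompact_closedBall (0 : ℂ) r).prod
        (isCompact_closedBall (0 : ℂ) r))).of_isClosed_subset hTcl ?_
      rintro x hx
      exact ⟨hx.1.1.1, hx.1.1.2, hx.2.1.1.2⟩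
    convert (hTc.image continuous_fst).isClosed using 1
    ext s
    constructor
    · rintro ⟨⟨a, b, hab, ha, hb, hka, hkb⟩, hs⟩
      exact ⟨(s, a, b), ⟨⟨⟨hs, by simpa using ha⟩, hka⟩, ⟨⟨hs, by simpa using hb⟩, hkb⟩, hab⟩, rfl⟩
    · rintro ⟨⟨s, a, b⟩, ⟨⟨⟨hs, ha⟩, hka⟩, ⟨⟨-, hb⟩, hkb⟩, hab⟩, rfl⟩
      exact ⟨⟨a, b, hab, by simpa using ha, by simpa using hb, hka, hkb⟩, hs⟩
  have h1 : (1 : ℝ) ∈ S := by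
    refine ⟨z₁, z₂, hne, hr.1, hr.2, ?_, ?_⟩
    · rw [hc]; push_cast; ring
    · rw [heq]; push_cast; ring
  have h0 : (0 : ℝ) ∈ S := by
    refine hcl.Icc_subset_of_forall_exists_lt h1 ?_ ⟨le_rfl, zero_le_one⟩
    rintro s ⟨⟨a, b, hab, ha, hb, hka, hkb⟩, hs⟩ y hy
    obtain ⟨ψ, hψc, hψ, hψ1, hψ2⟩ := h.exists_local_flow hs.1 (hdisk ha) hka
    obtain ⟨χ, hχc, hχ, hχ1, hχ2⟩ := h.exists_local_flow hs.1 (hdisk hb) hkb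
    have hne' : ∀ᶠ t in 𝓝 s, ψ t ≠ χ t := by
      have : ∀ᶠ t in 𝓝 s, ψ t - χ t ≠ 0 :=
        (hψc.sub hχc).eventually_ne (by simpa [hψ, hχ, sub_eq_zero] using hab)
      filter_upwards [this] with t ht using sub_ne_zero.1 ht
    obtain ⟨t, ⟨⟨ht1, ht2, ht3⟩, ht4, ht5⟩, ht6⟩ :=
      ((((hψ1.and (hχ1.and hne')).filter_mono nhdsWithin_le_nhds).and (hψ2.and hχ2)).and
        (Ico_mem_nhdsLT hy)).exists
    exact ⟨t, ⟨ψ t, χ t, ht3, ht4.trans ha, ht5.trans hb, ht1, ht2⟩, ht6⟩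
  obtain ⟨a, b, hab, ha, hb, hka, hkb⟩ := h0
  simp only [ofReal_zero, zero_mul, add_zero] at hka hkb
  exact hab ((h.eq_zero (hdisk ha) hka).trans (h.eq_zero (hdisk hb) hkb).symm)

end StarlikePair

end DiffSubord

/-! ### Passing from principal powers to powers defined by the logarithm. -/

namespace DiffSubord

/-- `p^{a+1} + δ p^a + p^a z p' / (β p + γ)` with powers formed from the logarithm `L` of `p`. -/
noncomputable def logExpr (a : ℝ) (β γ δ : ℂ) (L p : ℂ → ℂ) (z : ℂ) : ℂ :=
  exp (((a + 1 : ℝ) : ℂ) * L z) + δ * exp ((a : ℂ) * L z) +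
    exp ((a : ℂ) * L z) * quotTerm β γ p z

theorem exp_add_one_mul {L p : ℂ → ℂ} (h : IsLogOf L p) (a : ℝ) {z : ℂ} (hz : z ∈ disk) :
    exp (((a + 1 : ℝ) : ℂ) * L z) = exp (a * L z) * p z := by
  rw [← h.2.2 z hz, ← exp_add]
  push_cast
  ring_nf

theorem logExpr_eq {L p : ℂ → ℂ} (h : IsLogOf L p) (a : ℝ) (β γ δ : ℂ) {z : ℂ}
    (hz : z ∈ disk) :
    logExpr a β γ δ L p z = exp (a * L z) * (p z + δ + quotTerm β γ p z) := by
  rw [logExpr, exp_add_one_mul h a hz]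
  ring

theorem differentiableOn_quotTerm {β γ : ℂ} {p : ℂ → ℂ} (hp : DifferentiableOn ℂ p disk)
    (hden : ∀ z ∈ disk, β * p z + γ ≠ 0) : DifferentiableOn ℂ (quotTerm β γ p) disk :=
  (differentiableOn_id.mul (hp.deriv isOpen_disk)).div ((hp.const_mul β).add_const γ) hden

theorem differentiableOn_logExpr {a : ℝ} {β γ δ : ℂ} {L p : ℂ → ℂ}
    (hL : DifferentiableOn ℂ L disk) (hp : DifferentiableOn ℂ p disk)
    (hden : ∀ z ∈ disk, β * p z + γ ≠ 0) :
    DifferentiableOn ℂ (logExpr a β γ δ L p) disk :=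
  (((hL.const_mul _).cexp).add ((hL.const_mul _).cexp.const_mul δ)).add
    ((hL.const_mul _).cexp.mul (differentiableOn_quotTerm hp hden))

theorem logExpr_zero {a : ℝ} {β γ δ : ℂ} {L p : ℂ → ℂ} (h : L 0 = 0) :
    logExpr a β γ δ L p 0 = 1 + δ := by
  simp [logExpr, quotTerm, h]

theorem norm_powExpr {α μ : ℝ} {β γ δ : ℂ} {L p : ℂ → ℂ} (hμ : 0 < μ) (h : IsLogOf L p)
    {z : ℂ} (hz : z ∈ disk) :
    ‖powExpr α β γ δ μ p z‖ = ‖logExpr (α / μ) β γ δ L p z‖ ^ μ := by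
  rw [logExpr_eq h _ _ _ _ hz, powExpr, norm_mul, norm_mul, norm_cpow_real, norm_cpow_real,
    Real.mul_rpow (norm_nonneg _) (norm_nonneg _), ← h.2.2 z hz, norm_exp, norm_exp,
    re_ofReal_mul, ← Real.exp_mul, ← Real.exp_mul]
  have e : α / μ * (L z).re * μ = (L z).re * α := by field_simp
  rw [e]

/-- If `|F| = |G|^μ` near a simple zero of `G`, `F` is differentiable and `μ ≤ 1`, then
`μ = 1`. -/
theorem eq_one_of_norm_eq_rpow {F G : ℂ → ℂ} {μ : ℝ} (hμ0 : 0 < μ) (hμ1 : μ ≤ 1)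
    (hF : DifferentiableAt ℂ F 0) (hG : DifferentiableAt ℂ G 0) (hG0 : G 0 = 0)
    (hG' : deriv G 0 ≠ 0) (hFG : ∀ᶠ z in 𝓝 0, ‖F z‖ = ‖G z‖ ^ μ) : μ = 1 := by
  by_contra hne
  have hlt : 0 < 1 - μ := by
    have := lt_of_le_of_ne hμ1 hne
    linarith
  have hF0 : F 0 = 0 := by
    have := hFG.self_of_nhds
    rw [hG0, norm_zero, Real.zero_rpow hμ0.ne'] at this
    exact norm_eq_zero.1 this
  have h1 := (hasDerivAt_iff_tendsto_slope.1 hF.hasDerivAt).norm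
  have h2 := ((hasDerivAt_iff_tendsto_slope.1 hG.hasDerivAt).norm).rpow_const
    (p := μ) (Or.inr hμ0.le)
  -- Dividing by `‖z‖ ^ μ` gives `‖F z / z‖ * ‖z‖ ^ (1 - μ) = ‖G z / z‖ ^ μ`. For `μ < 1` the left
  -- side tends to 0, the right side to `‖deriv G 0‖ ^ μ ≠ 0`.
  have h3 : Tendsto (fun z : ℂ => ‖z‖ ^ (1 - μ)) (𝓝[≠] 0) (𝓝 0) := by
    have : Tendsto (fun z : ℂ => ‖z‖) (𝓝[≠] 0) (𝓝 0) := by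
      simpa using (continuous_norm.tendsto (0 : ℂ)).mono_left (nhdsWithin_le_nhds (s := {0}ᶜ))
    simpa [Real.zero_rpow hlt.ne'] using this.rpow_const (p := 1 - μ) (Or.inr hlt.le)
  have h4 := h1.mul h3
  rw [mul_zero] at h4
  have h5 : Tendsto (fun z => ‖slope G 0 z‖ ^ μ) (𝓝[≠] 0) (𝓝 0) := by
    refine h4.congr' ?_
    filter_upwards [hFG.filter_mono nhdsWithin_le_nhds, self_mem_nhdsWithin] with z hz hz0
    have hz0 : 0 < ‖z‖ := norm_pos_iff.2 hz0
    simp only [slope_def_field, hF0, hG0, sub_zero, norm_div]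
    rw [hz, Real.div_rpow (norm_nonneg _) hz0.le, Real.rpow_sub hz0, Real.rpow_one]
    have := Real.rpow_pos_of_pos hz0 μ
    field_simp
  have := tendsto_nhds_unique h2 h5
  exact absurd this (Real.rpow_pos_of_pos (norm_pos_iff.2 hG') μ).ne'

theorem powExpr_one_eventuallyEq {α : ℝ} {β γ δ : ℂ} {L p : ℂ → ℂ} (h : IsLogOf L p) :
    powExpr α β γ δ 1 p =ᶠ[𝓝 0] logExpr α β γ δ L p := by
  have hc : ContinuousAt L 0 :=
    (h.1.differentiableAt (isOpen_disk.mem_nhds zero_mem_disk)).continuousAt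
  have him : Tendsto (fun z => (L z).im) (𝓝 0) (𝓝 0) := by
    have := continuous_im.continuousAt.comp hc
    simpa [ContinuousAt, Function.comp_def, h.2.1] using this
  filter_upwards [isOpen_disk.mem_nhds zero_mem_disk,
    him.eventually_const_lt (neg_lt_zero.2 Real.pi_pos),
    him.eventually_lt_const Real.pi_pos] with z hz h1 h2
  rw [logExpr_eq h _ _ _ _ hz, powExpr, ofReal_one, cpow_one,
    cpow_def_of_ne_zero (by rw [← h.2.2 z hz]; exact exp_ne_zero _)]
  congr 2
  rw [← h.2.2 z hz, log_exp h1 h2.le, mul_comm]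

/-- Two analytic functions with the same modulus which agree at a point where they do not vanish
coincide. -/
theorem eqOn_of_norm_eq {f g : ℂ → ℂ} {U : Set ℂ} (hU : IsOpen U) (hUc : IsPreconnected U)
    (hf : DifferentiableOn ℂ f U) (hg : DifferentiableOn ℂ g U) {z₀ : ℂ} (hz₀ : z₀ ∈ U)
    (h0 : f z₀ = g z₀) (hne : g z₀ ≠ 0) (hn : ∀ z ∈ U, ‖f z‖ = ‖g z‖) : EqOn f g U := by
  refine (hf.analyticOnNhd hU).eqOn_of_preconnected_of_eventuallyEq (hg.analyticOnNhd hU) hUc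
    hz₀ ?_
  have hUn := hU.mem_nhds hz₀
  have hgne : ∀ᶠ z in 𝓝 z₀, g z ≠ 0 :=
    (hg.differentiableAt hUn).continuousAt.eventually_ne hne
  have hd : ∀ᶠ z in 𝓝 z₀, DifferentiableAt ℂ (fun z => f z / g z) z := by
    filter_upwards [hgne, hU.mem_nhds hz₀] with z h1 h2
    exact (hf.differentiableAt (hU.mem_nhds h2)).div (hg.differentiableAt (hU.mem_nhds h2)) h1
  have hmax : IsLocalMax (norm ∘ fun z => f z / g z) z₀ := by
    filter_upwards [hgne, hUn] with z h1 h2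
    simp only [Function.comp_apply, norm_div, hn z h2, hn z₀ hz₀]
    rw [div_self (norm_ne_zero_iff.2 h1), div_self (norm_ne_zero_iff.2 hne)]
  filter_upwards [eventually_eq_of_isLocalMax_norm hd hmax, hgne] with z h1 h2
  rw [h0, div_self hne, div_eq_one_iff_eq h2] at h1
  exact h1

/-- Both sides have equal modulus and the common value `1 + δ` at 0, which suffices if `1 + δ ≠ 0`.
If `1 + δ = 0`, univalence makes 0 a simple zero of G_q, so analyticity of F_q forces `μ = 1`; F and
G then agree near 0. -/
theorem logExpr_eq_comp {α μ : ℝ} {β γ δ : ℂ} (hμ0 : 0 < μ) (hμ1 : μ ≤ 1) {q p M L w : ℂ → ℂ}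
    (hq : ClassR α β γ δ μ q) (hp : ClassR α β γ δ μ p) (hM : IsLogOf M q) (hL : IsLogOf L p)
    (hinj : InjOn (logExpr (α / μ) β γ δ M q) disk)
    (hw : DifferentiableOn ℂ w disk) (hw0 : w 0 = 0) (hwm : ∀ z ∈ disk, ‖w z‖ < 1)
    (hF : ∀ z ∈ disk, powExpr α β γ δ μ q z = powExpr α β γ δ μ p (w z)) :
    ∀ z ∈ disk, logExpr (α / μ) β γ δ M q z = logExpr (α / μ) β γ δ L p (w z) := by
  have hmaps : MapsTo w disk disk := fun z hz => mem_disk.2 (hwm z hz)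
  have hGq := differentiableOn_logExpr (a := α / μ) (δ := δ) hM.1 hq.analytic hq.denom_ne_zero
  have hGp := differentiableOn_logExpr (a := α / μ) (δ := δ) hL.1 hp.analytic hp.denom_ne_zero
  have hGpw := hGp.comp hw hmaps
  have hn0 := isOpen_disk.mem_nhds zero_mem_disk
  by_cases hδ : 1 + δ = 0
  · have hμ : μ = 1 := by
      refine eq_one_of_norm_eq_rpow hμ0 hμ1 (hq.wellDefined.differentiableAt hn0)
        (hGq.differentiableAt hn0) ((logExpr_zero hM.2.1).trans hδ)
        (deriv_ne_zero_of_injOn isOpen_disk hGq hinj zero_mem_disk) ?_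
      filter_upwards [hn0] with z hz using norm_powExpr hμ0 hM hz
    subst hμ
    rw [div_one] at *
    refine (hGq.analyticOnNhd isOpen_disk).eqOn_of_preconnected_of_eventuallyEq
      (hGpw.analyticOnNhd isOpen_disk) isPreconnected_disk zero_mem_disk ?_
    have hwc : Tendsto w (𝓝 0) (𝓝 0) := by
      have := (hw.differentiableAt hn0).continuousAt
      rwa [ContinuousAt, hw0] at this
    filter_upwards [powExpr_one_eventuallyEq hM, hwc.eventually (powExpr_one_eventuallyEq hL),
      hn0] with z h1 h2 h3
    rw [← h1, hF z h3, h2]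
  · refine eqOn_of_norm_eq isOpen_disk isPreconnected_disk hGq hGpw zero_mem_disk ?_ ?_ ?_
    · simp only [hw0, logExpr_zero hM.2.1, logExpr_zero hL.2.1]
    · simpa only [Function.comp_apply, hw0, logExpr_zero hL.2.1] using hδ
    · intro z hz
      have h := congrArg norm (hF z hz)
      rw [norm_powExpr hμ0 hM hz, norm_powExpr hμ0 hL (hmaps hz)] at h
      exact (Real.rpow_left_inj (norm_nonneg _) (norm_nonneg _) hμ0.ne').1 h

/-! ### The starlike pair attached to q. -/

theorem exists_starlikePair {a : ℝ} {β γ δ : ℂ} {q M : ℂ → ℂ} (hqd : DifferentiableOn ℂ q disk)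
    (hqne : ∀ z ∈ disk, q z ≠ 0) (hden : ∀ z ∈ disk, β * q z + γ ≠ 0) (hq : InjOn q disk)
    (hM : IsLogOf M q)
    (h1 : ∀ z ∈ disk, 0 < ((β * q z + γ) * (1 + a + a * δ / q z)).re)
    (h2 : ∀ z ∈ disk, z ≠ 0 → 0 < (a * (z * deriv q z / q z) +
      z * deriv (quotTerm β γ q) z / quotTerm β γ q z).re) :
    ∃ Q₁ P H : ℂ → ℂ, StarlikePair (fun z => exp (a * M z) * quotTerm β γ q z)
      (fun z => exp (((a + 1 : ℝ) : ℂ) * M z) + δ * exp (a * M z)) Q₁ P H := by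
  set Q : ℂ → ℂ := fun z => exp (a * M z) * quotTerm β γ q z with hQ
  set Q₁ : ℂ → ℂ := fun z => exp (a * M z) * (deriv q z / (β * q z + γ)) with hQ₁
  have hq' : ∀ z ∈ disk, deriv q z ≠ 0 := fun z hz => deriv_ne_zero_of_injOn isOpen_disk hqd hq hz
  have hQ₁ne : ∀ z ∈ disk, Q₁ z ≠ 0 := fun z hz =>
    mul_ne_zero (exp_ne_zero _) (div_ne_zero (hq' z hz) (hden z hz))
  have hQeq : ∀ z, Q z = z * Q₁ z := fun z => by simp only [hQ, hQ₁, quotTerm]; ring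
  have hR := differentiableOn_quotTerm hqd hden
  have hMd : ∀ z ∈ disk, ∀ b : ℂ,
      HasDerivAt (fun z => exp (b * M z)) (exp (b * M z) * (b * (deriv q z / q z))) z :=
    fun z hz b => ((hasDerivAt_of_isLogOf hM hz).const_mul b).cexp
  have hQd : ∀ z ∈ disk, HasDerivAt Q (exp (a * M z) * (a * (deriv q z / q z)) * quotTerm β γ q z +
      exp (a * M z) * deriv (quotTerm β γ q) z) z := fun z hz =>
    (hMd z hz a).mul (hR.differentiableAt (isOpen_disk.mem_nhds hz)).hasDerivAt
  refine ⟨Q₁, fun z => deriv Q z / Q₁ z, fun z => (β * q z + γ) * (1 + a + a * δ / q z),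
    hQeq, hQ₁ne, ?_, ?_, ?_, h1⟩
  · intro z hz
    rw [mul_div_cancel₀ _ (hQ₁ne z hz)]
    exact (hQd z hz).differentiableAt.hasDerivAt
  · intro z hz
    refine ((hMd z hz _).add ((hMd z hz a).const_mul δ)).congr_deriv ?_
    rw [exp_add_one_mul hM a hz]
    have e1 := hqne z hz
    have e2 := hden z hz
    simp only [hQ₁]
    generalize β * q z + γ = D at e2 ⊢
    push_cast
    field_simp
    ring
  · intro z hz
    have hDne := hQ₁ne z hz
    -- The hypothesis `h2` omits the origin, where `P 0 = Q'(0) / Q₁ 0 = 1`.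
    by_cases hz0 : z = 0
    · subst hz0
      have hQ₁c : ContinuousAt Q₁ 0 := by
        have hd : DifferentiableOn ℂ Q₁ disk := (hM.1.const_mul _).cexp.mul
          ((hqd.deriv isOpen_disk).div ((hqd.const_mul β).add_const γ) hden)
        exact (hd.differentiableAt (isOpen_disk.mem_nhds hz)).continuousAt
      have hd : HasDerivAt Q (Q₁ 0) 0 := by
        rw [hasDerivAt_iff_tendsto_slope]
        refine (hQ₁c.tendsto.mono_left nhdsWithin_le_nhds).congr' ?_
        filter_upwards [self_mem_nhdsWithin] with z hz0
        have hz0 : z ≠ 0 := hz0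
        rw [slope_def_field, hQeq, hQeq]
        field_simp
        ring
      simp only [hd.deriv]
      rw [div_self hDne]
      simp
    · convert h2 z hz hz0 using 2
      rw [(hQd z hz).deriv]
      have e1 := hqne z hz
      have e2 := hden z hz
      have e3 := hq' z hz
      have e4 := exp_ne_zero ((a : ℂ) * M z)
      have e5 : quotTerm β γ q z = z * deriv q z / (β * q z + γ) := rfl
      simp only [hQ₁, e5]
      generalize β * q z + γ = D at e2 ⊢
      field_simp

/-- Univalence of `logExpr` for `q`. -/
theorem injOn_logExpr {a : ℝ} {β γ δ : ℂ} {q M Q₁ P H : ℂ → ℂ}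
    (h : StarlikePair (fun z => exp (a * M z) * quotTerm β γ q z)
      (fun z => exp (((a + 1 : ℝ) : ℂ) * M z) + δ * exp (a * M z)) Q₁ P H) :
    InjOn (logExpr a β γ δ M q) disk := h.injOn

/-! ### Inclusion of the images and subordination. -/

theorem image_subset_of_logExpr_eq {a : ℝ} {β γ δ : ℂ} {q p M L w Q₁ P H : ℂ → ℂ}
    (h : StarlikePair (fun z => exp (a * M z) * quotTerm β γ q z)
      (fun z => exp (((a + 1 : ℝ) : ℂ) * M z) + δ * exp (a * M z)) Q₁ P H)
    (hqd : DifferentiableOn ℂ q disk) (hpd : DifferentiableOn ℂ p disk) (hp : InjOn p disk)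
    (hq0 : q 0 = 1) (hp0 : p 0 = 1) (hM : IsLogOf M q) (hL : IsLogOf L p)
    (hinj : InjOn (logExpr a β γ δ L p) disk)
    (hw : DifferentiableOn ℂ w disk) (hw0 : w 0 = 0) (hwm : ∀ z ∈ disk, ‖w z‖ < 1)
    (hG : ∀ z ∈ disk, logExpr a β γ δ M q z = logExpr a β γ δ L p (w z)) :
    q '' disk ⊆ p '' disk := by
  rintro _ ⟨x₀, hx₀, rfl⟩
  -- Working with `p` on the closed disk of radius `r < 1` avoids any boundary behaviour of `p`.
  obtain ⟨r, hr0, hr1⟩ := exists_between (mem_disk.1 hx₀)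
  have hrpos : 0 < r := (norm_nonneg _).trans_lt hr0
  have hball : closedBall (0 : ℂ) r ⊆ disk := closedBall_subset_ball hr1
  suffices hs : q x₀ ∈ p '' ball 0 r from
    image_mono (ball_subset_closedBall.trans hball) hs
  by_contra hcon
  have hxr : closedBall (0 : ℂ) ‖x₀‖ ⊆ disk := (closedBall_subset_closedBall hr0.le).trans hball
  set g := Function.invFunOn p disk with hg
  have hgp : ∀ z ∈ disk, g (p z) = z := fun z hz => hp.leftInvOn_invFunOn hz
  have hopen : IsOpen (p '' ball 0 r) := by
    rw [isOpen_iff_mem_nhds]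
    rintro _ ⟨x, hx, rfl⟩
    have hb : ball (0 : ℂ) r ⊆ disk := ball_subset_closedBall.trans hball
    exact (deriv_ne_zero_and_differentiableAt_inv isOpen_ball (hpd.mono hb)
      (fun z hz => hgp z (hb hz)) hx).2.2
  set C : Set ℂ := closedBall 0 ‖x₀‖ ∩ q ⁻¹' (p '' ball 0 r)ᶜ with hC
  have hCc : IsCompact C := (isCompact_closedBall _ _).of_isClosed_subset
    ((hqd.continuousOn.mono hxr).preimage_isClosed_of_isClosed isClosed_closedBall
      hopen.isClosed_compl) inter_subset_left
  -- A point of least modulus at which `q` leaves `p '' ball 0 r`.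
  obtain ⟨z₀, hz₀C, hmin⟩ := hCc.exists_isMinOn ⟨x₀, by simp, hcon⟩ continuous_norm.continuousOn
  have hz₀r : ‖z₀‖ < r := (by simpa using hz₀C.1 : ‖z₀‖ ≤ ‖x₀‖).trans_lt hr0
  have hz₀0 : z₀ ≠ 0 := by
    rintro rfl
    exact hz₀C.2 ⟨0, mem_ball_self hrpos, by rw [hp0, hq0]⟩
  have hn₀ : 0 < ‖z₀‖ := norm_pos_iff.2 hz₀0
  have hsub : closedBall (0 : ℂ) ‖z₀‖ ⊆ disk :=
    (closedBall_subset_closedBall hz₀r.le).trans hball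
  have hz₀d : z₀ ∈ disk := hsub (by simp)
  have hin : ∀ x ∈ ball (0 : ℂ) ‖z₀‖, q x ∈ p '' ball 0 r := by
    intro x hx
    by_contra hx'
    have hx := mem_ball_zero_iff.1 hx
    have h1 : x ∈ C := ⟨by
      have : ‖z₀‖ ≤ ‖x₀‖ := by simpa using hz₀C.1
      simpa using hx.le.trans this, hx'⟩
    exact absurd (hmin h1) (not_le.2 hx)
  have hcl : ∀ x ∈ closedBall (0 : ℂ) ‖z₀‖, q x ∈ p '' closedBall 0 r := by
    intro x hx
    have hclosed : IsClosed (p '' closedBall 0 r) :=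
      ((isCompact_closedBall _ _).image_of_continuousOn (hpd.continuousOn.mono hball)).isClosed
    rw [← closure_ball _ hn₀.ne'] at hx
    have hxd : x ∈ disk := hsub (closure_ball (0 : ℂ) hn₀.ne' ▸ hx)
    have hcx : ContinuousWithinAt q (ball 0 ‖z₀‖) x :=
      (hqd.differentiableAt (isOpen_disk.mem_nhds hxd)).continuousAt.continuousWithinAt
    exact closure_minimal (image_mono ball_subset_closedBall) hclosed
      (hcx.mem_closure hx hin)
  set ω : ℂ → ℂ := fun x => g (q x) with hω
  have hωp : ∀ x ∈ closedBall (0 : ℂ) ‖z₀‖, ω x ∈ closedBall 0 r ∧ p (ω x) = q x := by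
    intro x hx
    obtain ⟨y, hy, hyx⟩ := hcl x hx
    have : ω x = y := by simp only [hω, ← hyx, hgp y (hball hy)]
    rw [this]
    exact ⟨hy, hyx⟩
  have hωd : ∀ x ∈ closedBall (0 : ℂ) ‖z₀‖, DifferentiableAt ℂ ω x := by
    intro x hx
    have h1 := (deriv_ne_zero_and_differentiableAt_inv isOpen_disk hpd hgp
      (hball (hωp x hx).1)).2.1
    rw [(hωp x hx).2] at h1
    exact h1.comp x (hqd.differentiableAt (isOpen_disk.mem_nhds (hsub hx)))
  have hω0 : ω 0 = 0 := by
    simp only [hω, hq0, ← hp0]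
    exact hgp 0 zero_mem_disk
  have hz₀m : z₀ ∈ closedBall (0 : ℂ) ‖z₀‖ := by simp
  have hωz₀ : ‖ω z₀‖ = r := by
    refine le_antisymm (by simpa using (hωp z₀ hz₀m).1) (not_lt.1 fun hlt => ?_)
    exact hz₀C.2 ⟨ω z₀, by simpa using hlt, (hωp z₀ hz₀m).2⟩
  have hle : ∀ z, ‖z‖ ≤ ‖z₀‖ → ‖ω z‖ ≤ ‖ω z₀‖ / ‖z₀‖ * ‖z‖ := by
    intro z hz
    rw [hωz₀]
    rcases hz.lt_or_eq with hz | hz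
    · have := dist_le_div_mul_dist_of_mapsTo_ball (f := ω) (c := 0) (R₁ := ‖z₀‖) (R₂ := r) (z := z)
        (fun x hx => (hωd x (ball_subset_closedBall hx)).differentiableWithinAt)
        (by rw [hω0]; exact fun x hx => (hωp x (ball_subset_closedBall hx)).1) (by simpa using hz)
      simpa [hω0] using this
    · rw [hz, div_mul_cancel₀ _ hn₀.ne']
      simpa using (hωp z (by simp [hz])).1
  obtain ⟨m, hm1, hm⟩ := jack (hωd z₀ hz₀m)
    (norm_ne_zero_iff.1 (by rw [hωz₀]; exact hrpos.ne')) hz₀0 hle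
  have hchain : ∀ x ∈ closedBall (0 : ℂ) ‖z₀‖, (∀ᶠ y in 𝓝 x, p (ω y) = q y) →
      deriv p (ω x) * deriv ω x = deriv q x := by
    intro x hx hev
    have h1 := (hpd.differentiableAt
      (isOpen_disk.mem_nhds (hball (hωp x hx).1))).hasDerivAt.comp x (hωd x hx).hasDerivAt
    exact (h1.congr_of_eventuallyEq (hev.mono fun y hy => hy.symm)).deriv.symm
  -- Both logarithms have the same derivative and vanish at 0; continuity carries the equality to
  -- the boundary point `z₀`.
  have hlogball : EqOn (fun x => L (ω x)) M (ball 0 ‖z₀‖) := by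
    intro x hx
    have hder : ∀ y ∈ ball (0 : ℂ) ‖z₀‖, HasDerivAt (fun x => L (ω x) - M x) 0 y := by
      intro y hy
      have hyc := ball_subset_closedBall hy
      have hyd := hball (hωp y hyc).1
      have h1 := (hasDerivAt_of_isLogOf hL hyd).comp y (hωd y hyc).hasDerivAt
      refine (h1.sub (hasDerivAt_of_isLogOf hM (hsub hyc))).congr_deriv ?_
      rw [← hchain y hyc, (hωp y hyc).2]
      · ring
      · filter_upwards [isOpen_ball.mem_nhds hy] with u hu
        exact (hωp u (ball_subset_closedBall hu)).2
    have := isOpen_ball.is_const_of_deriv_eq_zero (convex_ball 0 ‖z₀‖).isPreconnected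
      (fun y hy => (hder y hy).differentiableAt.differentiableWithinAt)
      (fun y hy => (hder y hy).deriv) hx (mem_ball_self hn₀)
    simpa [hω0, hL.2.1, hM.2.1, sub_eq_zero] using this
  have hlog : L (ω z₀) = M z₀ := by
    refine hlogball.of_subset_closure (t := closedBall 0 ‖z₀‖) ?_ ?_ ball_subset_closedBall
      (closure_ball (0 : ℂ) hn₀.ne').ge hz₀m
    · intro x hx
      exact ((hL.1.differentiableAt (isOpen_disk.mem_nhds (hball (hωp x hx).1))).comp x
        (hωd x hx)).continuousAt.continuousWithinAt
    · exact hM.1.continuousOn.mono hsub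
  -- The chain rule at `z₀` needs a full neighbourhood, reaching outside the closed ball; it comes
  -- from openness of `p` on the whole disk.
  have hev₀ : ∀ᶠ y in 𝓝 z₀, p (ω y) = q y := by
    have himg := (deriv_ne_zero_and_differentiableAt_inv isOpen_disk hpd hgp
      (hball (hωp z₀ hz₀m).1)).2.2
    rw [(hωp z₀ hz₀m).2] at himg
    filter_upwards [(hqd.differentiableAt (isOpen_disk.mem_nhds hz₀d)).continuousAt.eventually
      himg] with y hy
    obtain ⟨x, hx, hxy⟩ := hy
    simp only [hω, ← hxy, hgp x hx]
  have hquot : quotTerm β γ q z₀ = m * quotTerm β γ p (ω z₀) := by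
    simp only [quotTerm, (hωp z₀ hz₀m).2]
    rw [← hchain z₀ hz₀m hev₀]
    linear_combination (deriv p (ω z₀) / (β * q z₀ + γ)) * hm
  -- Since the quotient term of `q` at `z₀` is `m` times that of `p` at `ω z₀`, the point `z₀` is a
  -- zero for parameter `m`; the flow brings it down to parameter 1.
  obtain ⟨z₂, hz₂, hk⟩ := h.exists_zero_of_le (c := logExpr a β γ δ L p (ω z₀)) one_pos hm1 hz₀d (by
    simp only [logExpr, hlog, hquot]
    ring)
  have hz₂d : z₂ ∈ disk := mem_disk.2 (hz₂.trans_lt (mem_disk.1 hz₀d))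
  have hk' : logExpr a β γ δ L p (w z₂) = logExpr a β γ δ L p (ω z₀) := by
    rw [← hG z₂ hz₂d]
    simp only [logExpr] at hk ⊢
    push_cast at hk ⊢
    linear_combination hk
  have heq := hinj (mem_disk.2 (hwm z₂ hz₂d)) (hball (hωp z₀ hz₀m).1) hk'
  have hwle : ‖w z₂‖ ≤ ‖z₂‖ := norm_le_norm_of_mapsTo_ball (R := 1) hw
    (fun z hz => by simpa using (hwm z hz).le) hw0 (mem_disk.1 hz₂d)
  rw [heq, hωz₀] at hwle
  linarith

theorem subordinate_of_image_subset {f g : ℂ → ℂ} (hf : DifferentiableOn ℂ f disk)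
    (hg : IsUnivalent g) (h0 : f 0 = g 0) (himg : f '' disk ⊆ g '' disk) : Subordinate f g := by
  set k := Function.invFunOn g disk
  have hk : ∀ z ∈ disk, k (g z) = z := fun z hz => hg.2.leftInvOn_invFunOn hz
  have key : ∀ z ∈ disk, k (f z) ∈ disk ∧ g (k (f z)) = f z := by
    intro z hz
    obtain ⟨y, hy, hyz⟩ := himg ⟨z, hz, rfl⟩
    rw [← hyz, hk y hy]
    exact ⟨hy, rfl⟩
  refine ⟨hf, hg.1, fun z => k (f z), fun z hz => ?_, ?_, fun z hz => mem_disk.1 (key z hz).1,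
    fun z hz => (key z hz).2.symm⟩
  · have h1 := (deriv_ne_zero_and_differentiableAt_inv isOpen_disk hg.1 hk (key z hz).1).2.1
    rw [(key z hz).2] at h1
    exact (h1.comp z (hf.differentiableAt (isOpen_disk.mem_nhds hz))).differentiableWithinAt
  · simp only [h0]
    exact hk 0 zero_mem_disk

theorem Subordinate.refl {f : ℂ → ℂ} (hf : DifferentiableOn ℂ f disk) : Subordinate f f :=
  ⟨hf, hf, id, differentiableOn_id, rfl, fun _ hz => mem_disk.1 hz, fun _ _ => rfl⟩

theorem disk_subset_closedBall_diff (f : ℂ → ℂ) :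
    disk ⊆ closedBall 0 1 \ infinitePoints f := fun z hz =>
  ⟨ball_subset_closedBall hz, fun h => by
    have h1 := mem_disk.1 hz
    have h2 : ‖z‖ = 1 := by simpa using h.1
    linarith⟩

theorem ClassQ.injOn {f : ℂ → ℂ} (h : ClassQ f) : InjOn f disk := by
  obtain ⟨g, hgf, -, hinj, -⟩ := h
  exact (hinj.mono (disk_subset_closedBall_diff f)).congr hgf

end DiffSubord

/-! ### The theorem. -/

open DiffSubord

theorem theorem2 (α μ : ℝ) (β γ δ : ℂ)
    (hμ0 : 0 < μ) (hμ1 : μ ≤ 1) (hαμ : 0 ≤ α + μ) (hβ : β ≠ 0)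
    (q : ℂ → ℂ) (hqR : DiffSubord.ClassR α β γ δ μ q) (hq : DiffSubord.IsUnivalent q)
    (h1 : ∀ z ∈ DiffSubord.disk,
      0 < ((β * q z + γ) * (1 + (α : ℂ) / μ + α * δ / (μ * q z))).re)
    -- at `z = 0` the singularity is removable, with value `1`
    (h2 : ∀ z ∈ DiffSubord.disk, z ≠ 0 →
      0 < ((α : ℂ) / μ * (z * deriv q z / q z) +
        z * deriv (DiffSubord.quotTerm β γ q) z / DiffSubord.quotTerm β γ q z).re) :
    (∀ p : ℂ → ℂ, DiffSubord.ClassR α β γ δ μ p → DiffSubord.ClassQ p →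
      DiffSubord.ExprUnivalent α β γ δ μ p →
      DiffSubord.Subordinate (DiffSubord.powExpr α β γ δ μ q)
        (DiffSubord.powExpr α β γ δ μ p) →
      DiffSubord.Subordinate q p) ∧
    DiffSubord.IsBestSubordinant
      (DiffSubord.solutions α β γ δ μ (DiffSubord.powExpr α β γ δ μ q)) q := by
  obtain ⟨M, hM⟩ := exists_isLogOf hqR.analytic hqR.map_zero hqR.ne_zero
  obtain ⟨Q₁, P, H, hpair⟩ := exists_starlikePair (a := α / μ) (δ := δ) hqR.analytic hqR.ne_zero
    hqR.denom_ne_zero hq.2 hM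
    (fun z hz => by
      convert h1 z hz using 4
      · push_cast; rfl
      · have := hqR.ne_zero z hz
        push_cast
        field_simp)
    (fun z hz hz0 => by
      convert h2 z hz hz0 using 4
      push_cast; rfl)
  have hGq := injOn_logExpr hpair
  have main : ∀ p : ℂ → ℂ, ClassR α β γ δ μ p → IsUnivalent p → ExprUnivalent α β γ δ μ p →
      Subordinate (powExpr α β γ δ μ q) (powExpr α β γ δ μ p) → Subordinate q p := by
    rintro p hpR hp ⟨L, hL, hGp⟩ ⟨-, -, w, hw, hw0, hwm, hF⟩
    have hG := logExpr_eq_comp hμ0 hμ1 hqR hpR hM hL hGq hw hw0 hwm hF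
    exact subordinate_of_image_subset hqR.analytic hp (hqR.map_zero.trans hpR.map_zero.symm)
      (image_subset_of_logExpr_eq hpair hqR.analytic hpR.analytic hp.2 hqR.map_zero hpR.map_zero
        hM hL hGp.2 hw hw0 hwm hG)
  refine ⟨fun p hpR hpQ => main p hpR ⟨hpR.analytic, hpQ.injOn⟩, hq,
    ⟨hq.1, fun p hp => main p hp.1 hp.2.1 hp.2.2.1 hp.2.2.2⟩, fun s hs => hs.2 q ?_⟩
  -- `q` is itself a solution, so every subordinant is subordinate to it.
  exact ⟨hqR, hq, ⟨M, hM, differentiableOn_logExpr hM.1 hqR.analytic hqR.denom_ne_zero, hGq⟩,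
    Subordinate.refl hqR.wellDefined⟩
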